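/- Let $X$ be a completely regular Hausdorff topological space and let $\psi\colon X\to(0,\infty)$ be an admissible weight function, i.e. the sets $K_R=\{x\in X:\psi(x)\le R\}$ are compact for all $R>0$. Let $\mathrm{B}^\psi(X)$ be the space of all functions $f\colon X\to\mathbb{R}$ with $\|f\|_\psi:=\sup_{x\in X}\psi(x)^{-1}|f(x)|<\infty$, normed by $\|\cdot\|_\psi$, and let $\mathcal{B}^\psi(X)$ be the closure in $\mathrm{B}^\psi(X)$ of the space of bounded continuous functions $X\to\mathbb{R}$. Let $(P_t)_{t\ge 0}$ be a family of bounded linear operators $P_t\colon\mathcal{B}^\psi(X)\to\mathcal{B}^\psi(X)$ such that 1. $P_0=I$, the identity on $\mathcal{B}^\psi(X)$; 2. $P_{t+s}=P_tP_s$ for all $t,s\ge 0$; 3. $\lim_{t\to 0+}P_tf(x)=f(x)$ for all $f\in\mathcal{B}^\psi(X)$ and all $x\in X$; 4. there exist $C\in\mathbb{R}$ and $\varepsilon>0$ such that $\|P_t\|_{L(\mathcal{B}^\psi(X))}\le C$ for all $t\in[0,\varepsilon]$. Then $(P_t)_{t\ge 0}$ is strongly continuous on $\mathcal{B}^\psi(X)$,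 that is, $$\lim_{t\to 0+}\|P_tf-f\|_\psi=0\quad\text{for all } f\in\mathcal{B}^\psi(X).$$ -/

import Mathlib

open Filter Topology
open scoped NNReal

/-- An admissible weight function on `X`: a function `ψ : X → (0, ∞)` whose sublevel sets
`K_R = {x | ψ x ≤ R}` are compact for all `R > 0`. -/
structure AdmissibleWeight (X : Type*) [TopologicalSpace X] where
  toFun : X → ℝ
  pos : ∀ x, 0 < toFun x
  isCompact_sublevel : ∀ R : ℝ, 0 < R → IsCompact {x | toFun x ≤ R}

namespace AdmissibleWeight

variable {X : Type*} [TopologicalSpace X]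

instance : CoeFun (AdmissibleWeight X) (fun _ => X → ℝ) := ⟨AdmissibleWeight.toFun⟩

end AdmissibleWeight

/-- The space of all functions `f : X → ℝ` with `sup_x ψ(x)⁻¹ |f(x)| < ∞`. -/
@[ext]
structure WeightedBounded {X : Type*} [TopologicalSpace X] (ψ : AdmissibleWeight X) where
  toFun : X → ℝ
  bddAbove : BddAbove (Set.range fun x => (ψ x)⁻¹ * |toFun x|)

namespace WeightedBounded

variable {X : Type*} [TopologicalSpace X] {ψ : AdmissibleWeight X}

instance : CoeFun (WeightedBounded ψ) (fun _ => X → ℝ) := ⟨WeightedBounded.toFun⟩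

theorem toFun_injective :
    Function.Injective (WeightedBounded.toFun : WeightedBounded ψ → X → ℝ) :=
  fun _ _ h => WeightedBounded.ext h

theorem inv_weight_pos (x : X) : 0 < (ψ x)⁻¹ := inv_pos.2 (ψ.pos x)

theorem bddAbove_add (f g : WeightedBounded ψ) :
    BddAbove (Set.range fun x => (ψ x)⁻¹ * |f x + g x|) := by
  obtain ⟨A, hA⟩ := f.bddAbove
  obtain ⟨B, hB⟩ := g.bddAbove
  refine ⟨A + B, ?_⟩
  rintro _ ⟨x, rfl⟩
  have h1 : (ψ x)⁻¹ * |f x| ≤ A := hA ⟨x, rfl⟩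
  have h2 : (ψ x)⁻¹ * |g x| ≤ B := hB ⟨x, rfl⟩
  have h3 : (ψ x)⁻¹ * |f x + g x| ≤ (ψ x)⁻¹ * (|f x| + |g x|) :=
    mul_le_mul_of_nonneg_left (abs_add_le _ _) (inv_weight_pos x).le
  show (ψ x)⁻¹ * |f x + g x| ≤ A + B
  linarith [mul_add (ψ x)⁻¹ |f x| |g x|]

theorem bddAbove_smul (c : ℝ) (f : WeightedBounded ψ) :
    BddAbove (Set.range fun x => (ψ x)⁻¹ * |c * f x|) := by
  obtain ⟨A, hA⟩ := f.bddAbove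
  refine ⟨|c| * A, ?_⟩
  rintro _ ⟨x, rfl⟩
  have h1 : (ψ x)⁻¹ * |f x| ≤ A := hA ⟨x, rfl⟩
  show (ψ x)⁻¹ * |c * f x| ≤ |c| * A
  rw [abs_mul, mul_left_comm]
  exact mul_le_mul_of_nonneg_left h1 (abs_nonneg c)

instance : Zero (WeightedBounded ψ) :=
  ⟨⟨fun _ => 0, ⟨0, by rintro _ ⟨x, rfl⟩; simp⟩⟩⟩

instance : Add (WeightedBounded ψ) := ⟨fun f g => ⟨fun x => f x + g x, bddAbove_add f g⟩⟩

instance : Neg (WeightedBounded ψ) :=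
  ⟨fun f => ⟨fun x => -f x, by simpa only [abs_neg] using f.bddAbove⟩⟩

instance : Sub (WeightedBounded ψ) :=
  ⟨fun f g => ⟨fun x => f x - g x, by
    simp only [sub_eq_add_neg]
    exact bddAbove_add f (-g)⟩⟩

instance : SMul ℝ (WeightedBounded ψ) := ⟨fun c f => ⟨fun x => c * f x, bddAbove_smul c f⟩⟩

instance : SMul ℕ (WeightedBounded ψ) :=
  ⟨fun n f => ⟨fun x => n • f x, by
    simpa only [nsmul_eq_mul] using bddAbove_smul (n : ℝ) f⟩⟩

instance : SMul ℤ (WeightedBounded ψ) :=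
  ⟨fun n f => ⟨fun x => n • f x, by
    simpa only [zsmul_eq_mul] using bddAbove_smul (n : ℝ) f⟩⟩

instance : AddCommGroup (WeightedBounded ψ) :=
  toFun_injective.addCommGroup _ rfl (fun _ _ => rfl) (fun _ => rfl) (fun _ _ => rfl)
    (fun _ _ => rfl) (fun _ _ => rfl)

/-- Evaluation of functions, as an additive homomorphism. -/
def toFunHom : WeightedBounded ψ →+ (X → ℝ) where
  toFun := WeightedBounded.toFun
  map_zero' := rfl
  map_add' _ _ := rfl

instance : Module ℝ (WeightedBounded ψ) :=
  toFun_injective.module ℝ toFunHom (fun _ _ => rfl)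

/-- The weighted supremum norm `‖f‖_ψ = sup_x ψ(x)⁻¹ |f(x)|`. -/
noncomputable instance instNorm : Norm (WeightedBounded ψ) := ⟨fun f => ⨆ x, (ψ x)⁻¹ * |f x|⟩

theorem norm_def (f : WeightedBounded ψ) : ‖f‖ = ⨆ x, (ψ x)⁻¹ * |f x| := rfl

theorem le_norm (f : WeightedBounded ψ) (x : X) : (ψ x)⁻¹ * |f x| ≤ ‖f‖ :=
  le_ciSup f.bddAbove x

theorem norm_nonneg' (f : WeightedBounded ψ) : 0 ≤ ‖f‖ :=
  Real.iSup_nonneg fun x => mul_nonneg (inv_weight_pos x).le (abs_nonneg _)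

theorem norm_le_of {f : WeightedBounded ψ} {C : ℝ} (hC : 0 ≤ C)
    (h : ∀ x, (ψ x)⁻¹ * |f x| ≤ C) : ‖f‖ ≤ C :=
  Real.iSup_le h hC

/-- The weighted supremum norm satisfies the norm axioms. -/
noncomputable def groupNorm (ψ : AdmissibleWeight X) : AddGroupNorm (WeightedBounded ψ) where
  toFun f := ‖f‖
  map_zero' := le_antisymm
    (norm_le_of le_rfl fun x => by
      show (ψ x)⁻¹ * |(0 : ℝ)| ≤ 0
      simp) (norm_nonneg' _)
  add_le' f g := norm_le_of (add_nonneg (norm_nonneg' f) (norm_nonneg' g)) fun x => by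
    have h3 : (ψ x)⁻¹ * |f x + g x| ≤ (ψ x)⁻¹ * (|f x| + |g x|) :=
      mul_le_mul_of_nonneg_left (abs_add_le _ _) (inv_weight_pos x).le
    show (ψ x)⁻¹ * |f x + g x| ≤ ‖f‖ + ‖g‖
    linarith [mul_add (ψ x)⁻¹ |f x| |g x|, le_norm f x, le_norm g x]
  neg' f := by
    show (⨆ x, (ψ x)⁻¹ * |-f x|) = ⨆ x, (ψ x)⁻¹ * |f x|
    simp only [abs_neg]
  eq_zero_of_map_eq_zero' f hf := by
    apply WeightedBounded.ext
    funext x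
    have h0 : ‖f‖ = 0 := hf
    have h1 := le_norm f x
    rw [h0] at h1
    have h2 : |f x| ≤ 0 := nonpos_of_mul_nonpos_right h1 (inv_weight_pos x)
    exact abs_nonpos_iff.1 h2

noncomputable instance instNormedAddCommGroup : NormedAddCommGroup (WeightedBounded ψ) :=
  { (groupNorm ψ).toNormedAddCommGroup with
    toNorm := instNorm }

noncomputable instance : NormedSpace ℝ (WeightedBounded ψ) where
  norm_smul_le c f := norm_le_of (mul_nonneg (norm_nonneg c) (norm_nonneg' f)) fun x => by
    show (ψ x)⁻¹ * |c * f x| ≤ |c| * ‖f‖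
    rw [abs_mul, mul_left_comm]
    exact mul_le_mul_of_nonneg_left (le_norm f x) (abs_nonneg c)

end WeightedBounded

/-- The bounded continuous functions, as a linear subspace of the space of all functions `f`
with `sup_x ψ(x)⁻¹ |f(x)| < ∞`. (On a Hausdorff space, that supremum is automatically finite
for bounded continuous `f`, since `ψ` is then bounded away from `0`; see
`AdmissibleWeight.exists_mem_boundedContinuousSubmodule`.) -/
def boundedContinuousSubmodule {X : Type*} [TopologicalSpace X] (ψ : AdmissibleWeight X) :
    Submodule ℝ (WeightedBounded ψ) where
  carrier := {f | Continuous f.toFun ∧ ∃ C : ℝ, ∀ x, |f x| ≤ C}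
  zero_mem' := ⟨continuous_const, 0, fun x => by
    show |(0 : ℝ)| ≤ 0
    simp⟩
  add_mem' := by
    rintro f g ⟨hf, A, hA⟩ ⟨hg, B, hB⟩
    exact ⟨hf.add hg, A + B, fun x => (abs_add_le _ _).trans (add_le_add (hA x) (hB x))⟩
  smul_mem' := by
    rintro c f ⟨hf, A, hA⟩
    refine ⟨continuous_const.mul hf, |c| * A, fun x => ?_⟩
    show |c * f x| ≤ |c| * A
    rw [abs_mul]
    exact mul_le_mul_of_nonneg_left (hA x) (abs_nonneg c)

theorem AdmissibleWeight.exists_pos_le {X : Type*} [TopologicalSpace X] [T2Space X]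
    (ψ : AdmissibleWeight X) : ∃ c : ℝ, 0 < c ∧ ∀ x, c ≤ ψ x := by
  by_contra! h
  have hpos : ∀ n : ℕ, (0 : ℝ) < 1 / ((n : ℝ) + 1) := fun n => Nat.one_div_pos_of_nat
  obtain ⟨x, hx⟩ := IsCompact.nonempty_iInter_of_sequence_nonempty_isCompact_isClosed
    (fun n : ℕ => {x | ψ x ≤ 1 / ((n : ℝ) + 1)})
    (fun n x (hx : ψ x ≤ 1 / (((n + 1 : ℕ) : ℝ) + 1)) =>
      hx.trans (Nat.one_div_le_one_div (Nat.le_succ n)))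
    (fun n => by
      obtain ⟨x, hx⟩ := h _ (hpos n)
      exact ⟨x, hx.le⟩)
    (ψ.isCompact_sublevel _ (hpos 0))
    (fun n => (ψ.isCompact_sublevel _ (hpos n)).isClosed)
  obtain ⟨n, hn⟩ := exists_nat_one_div_lt (ψ.pos x)
  exact absurd (Set.mem_iInter.1 hx n) (not_le.2 hn)

theorem AdmissibleWeight.exists_mem_boundedContinuousSubmodule {X : Type*} [TopologicalSpace X]
    [T2Space X] (ψ : AdmissibleWeight X) (f : X → ℝ) (hf : Continuous f)
    (hb : ∃ C : ℝ, ∀ x, |f x| ≤ C) :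
    ∃ g ∈ boundedContinuousSubmodule ψ, g.toFun = f := by
  obtain ⟨c, hc, hcψ⟩ := ψ.exists_pos_le
  obtain ⟨C, hC⟩ := hb
  refine ⟨⟨f, c⁻¹ * C, ?_⟩, ⟨hf, C, hC⟩, rfl⟩
  rintro _ ⟨x, rfl⟩
  exact mul_le_mul (inv_anti₀ hc (hcψ x)) (hC x) (abs_nonneg _) (inv_pos.2 hc).le

/-- The space `𝓑^ψ(X)` of functions with growth controlled by `ψ`: the closure of the bounded
continuous functions with respect to the norm `‖·‖_ψ`, as a normed space with that norm. -/
abbrev ControlledGrowth {X : Type*} [TopologicalSpace X] (ψ : AdmissibleWeight X) : Type _ :=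
  ↥(boundedContinuousSubmodule ψ).topologicalClosure

section ContinuousFunctional

open scoped CompactlySupported
open MeasureTheory

variable {K : Type*} [TopologicalSpace K] [CompactSpace K]

/-- The modulus of a continuous linear functional on `C(K, ℝ)`, evaluated at a function which is
meant to be nonnegative. -/
noncomputable def functionalModulus (ℓ : StrongDual ℝ C(K, ℝ)) (f : C(K, ℝ)) : ℝ :=
  sSup {r | ∃ g : C(K, ℝ), (∀ x, |g x| ≤ f x) ∧ ℓ g = r}

theorem bddAbove_functionalModulus (ℓ : StrongDual ℝ C(K, ℝ)) (f : C(K, ℝ)) :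
    BddAbove {r | ∃ g : C(K, ℝ), (∀ x, |g x| ≤ f x) ∧ ℓ g = r} := by
  refine ⟨‖ℓ‖ * ‖f‖, ?_⟩
  rintro _ ⟨g, hg, rfl⟩
  refine (le_abs_self _).trans ((ℓ.le_opNorm g).trans ?_)
  refine mul_le_mul_of_nonneg_left ?_ (norm_nonneg _)
  exact (ContinuousMap.norm_le _ (norm_nonneg _)).2 fun x =>
    (hg x).trans ((le_abs_self _).trans (f.norm_coe_le_norm x))

theorem le_functionalModulus (ℓ : StrongDual ℝ C(K, ℝ)) {f g : C(K, ℝ)}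
    (h : ∀ x, |g x| ≤ f x) : ℓ g ≤ functionalModulus ℓ f :=
  le_csSup (bddAbove_functionalModulus ℓ f) ⟨g, h, rfl⟩

omit [CompactSpace K] in
theorem functionalModulus_le (ℓ : StrongDual ℝ C(K, ℝ)) {f : C(K, ℝ)} (hf : ∀ x, 0 ≤ f x) {a : ℝ}
    (h : ∀ g : C(K, ℝ), (∀ x, |g x| ≤ f x) → ℓ g ≤ a) : functionalModulus ℓ f ≤ a :=
  csSup_le ⟨_, 0, fun x => by simpa using hf x, rfl⟩ <| by
    rintro _ ⟨g, hg, rfl⟩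
    exact h g hg

theorem functionalModulus_nonneg (ℓ : StrongDual ℝ C(K, ℝ)) {f : C(K, ℝ)} (hf : ∀ x, 0 ≤ f x) :
    0 ≤ functionalModulus ℓ f := by
  simpa using le_functionalModulus ℓ (f := f) (g := 0) fun x => by simpa using hf x

theorem functionalModulus_add (ℓ : StrongDual ℝ C(K, ℝ)) {f₁ f₂ : C(K, ℝ)} (h₁ : ∀ x, 0 ≤ f₁ x)
    (h₂ : ∀ x, 0 ≤ f₂ x) :
    functionalModulus ℓ (f₁ + f₂) = functionalModulus ℓ f₁ + functionalModulus ℓ f₂ := by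
  apply le_antisymm
  · refine functionalModulus_le ℓ (fun x => add_nonneg (h₁ x) (h₂ x)) fun g hg => ?_
    let g₁ : C(K, ℝ) := ⟨fun x => max (-f₁ x) (min (g x) (f₁ x)), by fun_prop⟩
    have hg₁ : ∀ x, |g₁ x| ≤ f₁ x := fun x => by
      have := h₁ x
      exact abs_le.2 ⟨le_max_left _ _, max_le (by linarith) (min_le_right _ _)⟩
    have hg₂ : ∀ x, |(g - g₁) x| ≤ f₂ x := fun x => by
      have h1 := h₁ x
      have h2 := h₂ x
      obtain ⟨h3, h4⟩ := abs_le.1 (hg x)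
      rw [ContinuousMap.add_apply] at h3 h4
      show |g x - max (-f₁ x) (min (g x) (f₁ x))| ≤ f₂ x
      rw [abs_le]
      constructor <;> rcases max_cases (-f₁ x) (min (g x) (f₁ x)) with h | h <;>
        rcases min_cases (g x) (f₁ x) with h' | h' <;> linarith
    have h : ℓ g = ℓ g₁ + ℓ (g - g₁) := by rw [← map_add, add_sub_cancel]
    rw [h]
    exact add_le_add (le_functionalModulus ℓ hg₁) (le_functionalModulus ℓ hg₂)
  · rw [← le_sub_iff_add_le]
    refine functionalModulus_le ℓ h₁ fun g₁ hg₁ => ?_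
    rw [le_sub_iff_add_le, ← le_sub_iff_add_le']
    refine functionalModulus_le ℓ h₂ fun g₂ hg₂ => ?_
    rw [le_sub_iff_add_le', ← map_add]
    exact le_functionalModulus ℓ fun x => (abs_add_le _ _).trans (add_le_add (hg₁ x) (hg₂ x))

theorem functionalModulus_smul (ℓ : StrongDual ℝ C(K, ℝ)) {f : C(K, ℝ)} (hf : ∀ x, 0 ≤ f x) {c : ℝ}
    (hc : 0 ≤ c) : functionalModulus ℓ (c • f) = c * functionalModulus ℓ f := by
  have key : ∀ {c : ℝ}, 0 < c → ∀ {f : C(K, ℝ)}, (∀ x, 0 ≤ f x) →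
      functionalModulus ℓ (c • f) ≤ c * functionalModulus ℓ f := by
    intro c hc f hf
    refine functionalModulus_le ℓ (fun x => mul_nonneg hc.le (hf x)) fun g hg => ?_
    rw [← inv_mul_le_iff₀ hc, ← smul_eq_mul, ← map_smul]
    refine le_functionalModulus ℓ fun x => ?_
    rw [ContinuousMap.smul_apply, smul_eq_mul, abs_mul, abs_of_pos (inv_pos.2 hc),
      inv_mul_le_iff₀ hc]
    exact hg x
  rcases hc.eq_or_lt with rfl | hc
  · rw [zero_smul, zero_mul]
    refine le_antisymm (functionalModulus_le ℓ (fun _ => le_rfl) fun g hg => ?_)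
      (functionalModulus_nonneg ℓ fun _ => le_rfl)
    have : g = 0 := by
      ext x
      exact abs_nonpos_iff.1 (hg x)
    simp [this]
  · refine le_antisymm (key hc hf) ?_
    have h := key (inv_pos.2 hc) (f := c • f) fun x => mul_nonneg hc.le (hf x)
    rwa [inv_smul_smul₀ hc.ne', le_inv_mul_iff₀ hc] at h

/-- The real-valued continuous function underlying an element of `C_c(K, ℝ≥0)`. -/
def nnrealToReal (f : C_c(K, ℝ≥0)) : C(K, ℝ) := ⟨fun x => (f x : ℝ), by fun_prop⟩

/-- The modulus of a functional on `C(K, ℝ)`, as a positive linear functional. -/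
noncomputable def functionalModulusLinear (ℓ : StrongDual ℝ C(K, ℝ)) : C_c(K, ℝ≥0) →ₗ[ℝ≥0] ℝ≥0 where
  toFun f := ⟨functionalModulus ℓ (nnrealToReal f),
    functionalModulus_nonneg ℓ fun x => (f x).coe_nonneg⟩
  map_add' f g := NNReal.eq <| by
    refine Eq.trans ?_ (functionalModulus_add ℓ (fun x => (f x).coe_nonneg)
      (fun x => (g x).coe_nonneg))
    rfl
  map_smul' c f := NNReal.eq <| by
    refine Eq.trans ?_ (functionalModulus_smul ℓ (fun x => (f x).coe_nonneg) c.coe_nonneg)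
    rfl

/-- A continuous functional on `C(K, ℝ)` is dominated by integration against a finite measure. -/
theorem exists_finite_measure_abs_le [T2Space K] [MeasurableSpace K] [BorelSpace K]
    (ℓ : StrongDual ℝ C(K, ℝ)) :
    ∃ μ : Measure K, IsFiniteMeasure μ ∧ ∀ g : C(K, ℝ), |ℓ g| ≤ ∫ x, |g x| ∂μ := by
  refine ⟨NNRealRMK.rieszMeasure (functionalModulusLinear ℓ), inferInstance, fun g => ?_⟩
  let f : C_c(K, ℝ≥0) := ⟨⟨fun x => ‖g x‖₊, by fun_prop⟩, HasCompactSupport.of_compactSpace _⟩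
  have hf : ∀ x, |g x| = (f x : ℝ) := fun x => rfl
  simp_rw [hf]
  rw [NNRealRMK.integral_rieszMeasure]
  refine abs_le'.2 ⟨le_functionalModulus ℓ (f := nnrealToReal f) fun x => le_rfl, ?_⟩
  rw [← map_neg]
  exact le_functionalModulus ℓ (f := nnrealToReal f) fun x => (abs_neg _).le

/-- Bounded pointwise convergence in `C(K, ℝ)` implies weak convergence. -/
theorem ContinuousMap.tendsto_dual_of_pointwise [T2Space K] (ℓ : StrongDual ℝ C(K, ℝ))
    {ι : Type*} {l : Filter ι} [l.IsCountablyGenerated] {g : ι → C(K, ℝ)} {g₀ : C(K, ℝ)} {C : ℝ}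
    (hC : ∀ᶠ i in l, ‖g i‖ ≤ C) (hg : ∀ x, Tendsto (fun i => g i x) l (𝓝 (g₀ x))) :
    Tendsto (fun i => ℓ (g i)) l (𝓝 (ℓ g₀)) := by
  borelize K
  obtain ⟨μ, hμ, hle⟩ := exists_finite_measure_abs_le ℓ
  have hint : Tendsto (fun i => ∫ x, |(g i - g₀) x| ∂μ) l (𝓝 (∫ _, (0 : ℝ) ∂μ)) := by
    refine tendsto_integral_filter_of_dominated_convergence (fun _ => C + ‖g₀‖)
      (Eventually.of_forall fun i => (g i - g₀).continuous.abs.aestronglyMeasurable) ?_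
      (integrable_const _) (Eventually.of_forall fun x => ?_)
    · filter_upwards [hC] with i hi
      refine Eventually.of_forall fun x => ?_
      rw [Real.norm_eq_abs, abs_abs]
      exact ((g i - g₀).norm_coe_le_norm x).trans ((norm_sub_le _ _).trans (by gcongr))
    · simpa using ((hg x).sub_const (g₀ x)).abs
  rw [integral_zero] at hint
  rw [tendsto_iff_norm_sub_tendsto_zero]
  refine squeeze_zero (fun _ => norm_nonneg _) (fun i => ?_) hint
  rw [← map_sub]
  exact hle _

end ContinuousFunctional

namespace WeightedBounded

variable {X : Type*} [TopologicalSpace X] {ψ : AdmissibleWeight X}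

theorem abs_apply_le (f : WeightedBounded ψ) (x : X) : |f x| ≤ ψ x * ‖f‖ := by
  have := le_norm f x
  rwa [inv_mul_le_iff₀ (ψ.pos x)] at this

instance : CompleteSpace (WeightedBounded ψ) := by
  refine Metric.complete_of_cauchySeq_tendsto fun u hu => ?_
  have hpt : ∀ x, ∃ a, Tendsto (fun n => u n x) atTop (𝓝 a) := fun x => by
    refine cauchySeq_tendsto_of_complete (Metric.cauchySeq_iff.2 fun ε hε => ?_)
    obtain ⟨N, hN⟩ := Metric.cauchySeq_iff.1 hu (ε / ψ x) (div_pos hε (ψ.pos x))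
    refine ⟨N, fun m hm n hn => ?_⟩
    have h := hN m hm n hn
    rw [dist_eq_norm, lt_div_iff₀' (ψ.pos x)] at h
    exact (abs_apply_le (u m - u n) x).trans_lt h
  choose g hg using hpt
  have key : ∀ ε : ℝ, 0 < ε → ∃ N, ∀ n ≥ N, ∀ x, (ψ x)⁻¹ * |u n x - g x| ≤ ε := fun ε hε => by
    obtain ⟨N, hN⟩ := Metric.cauchySeq_iff.1 hu ε hε
    refine ⟨N, fun n hn x => ?_⟩
    refine le_of_tendsto (((hg x).const_sub (u n x)).abs.const_mul (ψ x)⁻¹) ?_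
    filter_upwards [eventually_ge_atTop N] with m hm
    have h := hN n hn m hm
    rw [dist_eq_norm] at h
    exact (le_norm (u n - u m) x).trans h.le
  obtain ⟨N, hN⟩ := key 1 one_pos
  let G : WeightedBounded ψ := ⟨g, ‖u N‖ + 1, by
    rintro _ ⟨x, rfl⟩
    have h1 := le_norm (u N) x
    have h2 := hN N le_rfl x
    have h3 : |g x| ≤ |u N x| + |u N x - g x| := by
      have := abs_sub (u N x) (u N x - g x)
      rwa [sub_sub_cancel] at this
    have h4 := mul_le_mul_of_nonneg_left h3 (inv_weight_pos (ψ := ψ) x).le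
    show (ψ x)⁻¹ * |g x| ≤ ‖u N‖ + 1
    linarith [mul_add (ψ x)⁻¹ |u N x| |u N x - g x|]⟩
  refine ⟨G, Metric.tendsto_atTop.2 fun ε hε => ?_⟩
  obtain ⟨M, hM⟩ := key (ε / 2) (half_pos hε)
  refine ⟨M, fun n hn => ?_⟩
  rw [dist_eq_norm]
  exact (norm_le_of (f := u n - G) (half_pos hε).le (hM n hn)).trans_lt (half_lt_self hε)

end WeightedBounded

namespace ControlledGrowth

variable {X : Type*} [TopologicalSpace X] {ψ : AdmissibleWeight X}

/-- Evaluation at a point, as a continuous functional on `𝓑^ψ(X)`. -/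
noncomputable def evalCLM (ψ : AdmissibleWeight X) (x : X) : StrongDual ℝ (ControlledGrowth ψ) :=
  LinearMap.mkContinuous
    { toFun := fun f => f.1 x
      map_add' := fun _ _ => rfl
      map_smul' := fun _ _ => rfl } (ψ x) fun f => WeightedBounded.abs_apply_le f.1 x

@[simp]
theorem evalCLM_apply (x : X) (f : ControlledGrowth ψ) : evalCLM ψ x f = f.1 x := rfl

/-- The functional `f ↦ ψ(x)⁻¹ f(x)` on `𝓑^ψ(X)`. -/
noncomputable def weightedEval (ψ : AdmissibleWeight X) (x : X) :
    WeakDual ℝ (ControlledGrowth ψ) :=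
  StrongDual.toWeakDual ((ψ x)⁻¹ • evalCLM ψ x)

theorem weightedEval_apply (x : X) (f : ControlledGrowth ψ) :
    weightedEval ψ x f = (ψ x)⁻¹ * f.1 x := rfl

theorem abs_weightedEval (x : X) (f : ControlledGrowth ψ) :
    |weightedEval ψ x f| = (ψ x)⁻¹ * |f.1 x| := by
  rw [weightedEval_apply, abs_mul, abs_of_pos (inv_pos.2 (ψ.pos x))]

/-- The weak-* closure of the functionals `f ↦ ψ(x)⁻¹ f(x)`. -/
def evalClosure (ψ : AdmissibleWeight X) : Set (WeakDual ℝ (ControlledGrowth ψ)) :=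
  closure (Set.range (weightedEval ψ))

theorem abs_apply_le_of_mem_evalClosure {φ : WeakDual ℝ (ControlledGrowth ψ)}
    (hφ : φ ∈ evalClosure ψ) (f : ControlledGrowth ψ) : |φ f| ≤ ‖f‖ := by
  have hcl : IsClosed {φ : WeakDual ℝ (ControlledGrowth ψ) | |φ f| ≤ ‖f‖} :=
    isClosed_le (WeakDual.eval_continuous f).abs continuous_const
  refine closure_minimal ?_ hcl hφ
  rintro _ ⟨x, rfl⟩
  show |weightedEval ψ x f| ≤ ‖f‖
  rw [abs_weightedEval]
  exact WeightedBounded.le_norm f.1 x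

theorem isCompact_evalClosure (ψ : AdmissibleWeight X) : IsCompact (evalClosure ψ) := by
  refine (WeakDual.isCompact_closedBall (0 : StrongDual ℝ (ControlledGrowth ψ)) 1).of_isClosed_subset
    isClosed_closure fun φ hφ => ?_
  have h : ‖WeakDual.toStrongDual φ - 0‖ ≤ 1 := by
    refine ContinuousLinearMap.opNorm_le_bound _ zero_le_one fun f => ?_
    rw [one_mul, sub_zero]
    exact abs_apply_le_of_mem_evalClosure hφ f
  exact (dist_eq_norm (WeakDual.toStrongDual φ) 0).trans_le h

instance : CompactSpace (evalClosure ψ) := isCompact_iff_compactSpace.1 (isCompact_evalClosure ψ)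

theorem functional_ext {φ φ' : StrongDual ℝ (ControlledGrowth ψ)}
    (h : ∀ f : ControlledGrowth ψ, f.1 ∈ boundedContinuousSubmodule ψ → φ f = φ' f) : φ = φ' := by
  have hdense : Dense {f : ControlledGrowth ψ | f.1 ∈ boundedContinuousSubmodule ψ} := by
    rw [Subtype.dense_iff]
    intro f hf
    refine closure_mono ?_ hf
    intro g hg
    exact ⟨⟨g, Submodule.le_topologicalClosure _ hg⟩, hg, rfl⟩
  exact DFunLike.coe_injective (φ.continuous.ext_on hdense φ'.continuous h)

/-- Every weak-* limit of weighted evaluations is a multiple of an evaluation. -/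
theorem exists_eq_smul_evalCLM [T2Space X] {φ : WeakDual ℝ (ControlledGrowth ψ)}
    (hφ : φ ∈ evalClosure ψ) :
    WeakDual.toStrongDual φ = 0 ∨ ∃ (c : ℝ) (x : X), WeakDual.toStrongDual φ = c • evalCLM ψ x := by
  obtain ⟨v, hv, hvφ⟩ := mem_closure_iff_ultrafilter.1 hφ
  obtain ⟨u, rfl⟩ : ∃ u : Ultrafilter X, u.map (weightedEval ψ) = v :=
    by
    rw [← Set.image_univ] at hv
    exact ⟨Ultrafilter.ofComapInfPrincipal hv, Ultrafilter.ofComapInfPrincipal_eq_of_map hv⟩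
  have hu : Tendsto (weightedEval ψ) u (𝓝 φ) := hvφ
  have hlim : ∀ f : ControlledGrowth ψ, Tendsto (fun x => (ψ x)⁻¹ * f.1 x) u (𝓝 (φ f)) := fun f =>
    ((WeakDual.eval_continuous f).tendsto φ).comp hu
  by_cases hR : ∃ R, 0 < R ∧ {x | ψ x ≤ R} ∈ u
  · obtain ⟨R, hR, hRu⟩ := hR
    obtain ⟨x, -, hx⟩ := (ψ.isCompact_sublevel R hR).ultrafilter_le_nhds' u hRu
    obtain ⟨a, ha, haψ⟩ := ψ.exists_pos_le
    have hmem : ∀ y, (ψ y)⁻¹ ∈ Set.Icc 0 a⁻¹ := fun y =>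
      ⟨(inv_pos.2 (ψ.pos y)).le, inv_anti₀ ha (haψ y)⟩
    obtain ⟨c, -, hc⟩ := (isCompact_Icc (a := (0 : ℝ)) (b := a⁻¹)).ultrafilter_le_nhds'
      (u.map fun y => (ψ y)⁻¹) (Ultrafilter.mem_map.2 (univ_mem' hmem))
    refine .inr ⟨c, x, functional_ext fun f hf => ?_⟩
    have hc' : Tendsto (fun y => (ψ y)⁻¹) u (𝓝 c) := hc
    exact tendsto_nhds_unique (hlim f) (hc'.mul ((hf.1.tendsto x).mono_left hx))
  · push Not at hR
    refine .inl (functional_ext fun f hf => ?_)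
    obtain ⟨C, hC⟩ := hf.2
    refine tendsto_nhds_unique (hlim f) ?_
    rw [zero_apply]
    have hinv : Tendsto (fun y => (ψ y)⁻¹) u (𝓝 0) := by
      refine tendsto_inv_atTop_zero.comp (tendsto_atTop.2 fun R => ?_)
      have h := hR (max R 1) (by positivity)
      rw [← Ultrafilter.compl_mem_iff_notMem] at h
      filter_upwards [h] with y hy
      exact (le_max_left _ _).trans (lt_of_not_ge fun h' => hy h').le
    exact hinv.zero_mul_isBoundedUnder_le ⟨C, eventually_map.2 (Eventually.of_forall hC)⟩

/-- The isometric embedding of `𝓑^ψ(X)` into the continuous functions on a compact space. -/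
noncomputable def toContinuousMap (ψ : AdmissibleWeight X) :
    ControlledGrowth ψ →ₗᵢ[ℝ] C(evalClosure ψ, ℝ) where
  toFun f := ⟨fun φ => φ.1 f, (WeakDual.eval_continuous f).comp continuous_subtype_val⟩
  map_add' f g := by
    ext φ
    exact map_add φ.1 f g
  map_smul' c f := by
    ext φ
    exact map_smul φ.1 c f
  norm_map' f := by
    refine le_antisymm ((ContinuousMap.norm_le _ (norm_nonneg _)).2 fun φ =>
      abs_apply_le_of_mem_evalClosure φ.2 f) ?_
    refine WeightedBounded.norm_le_of (norm_nonneg _) fun x => ?_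
    refine (abs_weightedEval x f).ge.trans ?_
    exact ContinuousMap.norm_coe_le_norm
      (⟨fun φ => φ.1 f, (WeakDual.eval_continuous f).comp continuous_subtype_val⟩ :
        C(evalClosure ψ, ℝ)) ⟨weightedEval ψ x, subset_closure ⟨x, rfl⟩⟩

/-- Bounded pointwise convergence in `𝓑^ψ(X)` implies weak convergence. -/
theorem tendsto_dual_of_pointwise [T2Space X] (ℓ : StrongDual ℝ (ControlledGrowth ψ))
    {ι : Type*} {l : Filter ι} [l.IsCountablyGenerated] {g : ι → ControlledGrowth ψ}
    {g₀ : ControlledGrowth ψ} {C : ℝ} (hC : ∀ᶠ i in l, ‖g i‖ ≤ C)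
    (hg : ∀ x, Tendsto (fun i => (g i).1 x) l (𝓝 (g₀.1 x))) :
    Tendsto (fun i => ℓ (g i)) l (𝓝 (ℓ g₀)) := by
  let J := toContinuousMap ψ
  obtain ⟨L, hL, -⟩ := exists_extension_norm_eq (LinearMap.range J.toLinearMap)
    (ℓ.comp (J.equivRange.symm.toContinuousLinearEquiv : _ →L[ℝ] ControlledGrowth ψ))
  have hLJ : ∀ f, L (J f) = ℓ f := fun f => by
    refine (hL (J.equivRange f)).trans ?_
    exact congrArg ℓ (J.equivRange.symm_apply_apply f)
  simp_rw [← hLJ]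
  refine ContinuousMap.tendsto_dual_of_pointwise L (C := C) (by simpa using hC) fun φ => ?_
  show Tendsto (fun i => WeakDual.toStrongDual φ.1 (g i)) l (𝓝 (WeakDual.toStrongDual φ.1 g₀))
  rcases exists_eq_smul_evalCLM φ.2 with h | ⟨c, x, h⟩
  · simpa [h] using tendsto_const_nhds
  · simpa [h] using (hg x).const_mul c

end ControlledGrowth

section Semigroup

open MeasureTheory

theorem measurable_of_tendsto_nhdsGT {v : ℝ → ℝ}
    (hv : ∀ s, Tendsto v (𝓝[>] s) (𝓝 (v s))) : Measurable v := by
  have hpos : ∀ n : ℕ, (0 : ℝ) < (n : ℝ) + 1 := fun n => n.cast_add_one_pos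
  refine measurable_of_tendsto_metrizable
    (f := fun (n : ℕ) (s : ℝ) => v ((⌊((n : ℝ) + 1) * s⌋ + 1) / ((n : ℝ) + 1))) (fun n => ?_)
    (tendsto_pi_nhds.2 fun s => ?_)
  · have h : Measurable fun k : ℤ => v (((k : ℝ) + 1) / ((n : ℝ) + 1)) := measurable_from_top
    exact h.comp (Int.measurable_floor.comp (measurable_const_mul _))
  · refine (hv s).comp (tendsto_nhdsWithin_iff.2 ⟨?_, Eventually.of_forall fun n => ?_⟩)
    · refine tendsto_of_tendsto_of_tendsto_of_le_of_le (h := fun n : ℕ => s + 1 / ((n : ℝ) + 1))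
        tendsto_const_nhds ?_ (fun n => ?_) (fun n => ?_)
      · simpa using tendsto_one_div_add_atTop_nhds_zero_nat.const_add s
      · show s ≤ _
        rw [le_div_iff₀ (hpos n), mul_comm]
        exact (Int.lt_floor_add_one _).le
      · show _ ≤ s + 1 / ((n : ℝ) + 1)
        rw [div_le_iff₀ (hpos n), add_mul s, div_mul_cancel₀ _ (hpos n).ne', mul_comm s]
        gcongr
        exact Int.floor_le _
    · show s < _
      rw [lt_div_iff₀ (hpos n), mul_comm]
      exact Int.lt_floor_add_one _

variable {E : Type*} [NormedAddCommGroup E] [NormedSpace ℝ E]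

theorem Submodule.exists_dual_ne_zero_of_notMem {M : Submodule ℝ E} (hM : IsClosed (M : Set E))
    {x : E} (hx : x ∉ M) : ∃ ℓ : StrongDual ℝ E, (∀ y ∈ M, ℓ y = 0) ∧ ℓ x ≠ 0 := by
  obtain ⟨ℓ, a, ha, hax⟩ := geometric_hahn_banach_closed_point M.convex hM hx
  have h0 : 0 < a := by simpa using ha 0 M.zero_mem
  refine ⟨ℓ, fun y hy => ?_, (h0.trans hax).ne'⟩
  by_contra hne
  have h := ha ((a / ℓ y) • y) (M.smul_mem _ hy)
  rw [map_smul, smul_eq_mul, div_mul_cancel₀ _ hne] at h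
  exact lt_irrefl _ h

variable [CompleteSpace E]

/-- A weakly right-continuous function into a Banach space is strongly measurable. -/
theorem stronglyMeasurable_of_weakly_rightContinuous {u : ℝ → E}
    (hu : ∀ (ℓ : StrongDual ℝ E) (s : ℝ), Tendsto (fun r => ℓ (u r)) (𝓝[>] s) (𝓝 (ℓ (u s)))) :
    StronglyMeasurable u := by
  let M : Submodule ℝ E := (Submodule.span ℝ (Set.range fun q : ℚ => u q)).topologicalClosure
  have hMcl : IsClosed (M : Set E) := Submodule.isClosed_topologicalClosure _
  have huM : ∀ s, u s ∈ M := fun s => by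
    by_contra hs
    obtain ⟨ℓ, hℓ, hne⟩ := Submodule.exists_dual_ne_zero_of_notMem hMcl hs
    refine hne (tendsto_nhds_unique_of_frequently_eq (hu ℓ s) tendsto_const_nhds ?_)
    rw [(nhdsGT_basis s).frequently_iff]
    intro b hb
    obtain ⟨q, hq⟩ := exists_rat_btwn hb
    exact ⟨q, hq, hℓ _ (Submodule.le_topologicalClosure _ (Submodule.subset_span ⟨q, rfl⟩))⟩
  have : TopologicalSpace.SeparableSpace M :=
    ((Set.countable_range _).isSeparable.span (R := ℝ)).closure.separableSpace
  have : CompleteSpace M := hMcl.completeSpace_coe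
  have : SecondCountableTopology M := UniformSpace.secondCountable_of_separable M
  borelize ↥M
  have hnorming := fun k : ℕ => exists_dual_vector'' ℝ (TopologicalSpace.denseSeq M k : E)
  choose ℓ hℓ hℓd using hnorming
  let ι : M → ℕ → ℝ := fun v k => ℓ k v
  have hι : MeasurableEmbedding ι := by
    refine Continuous.measurableEmbedding (by fun_prop) fun v w hvw => ?_
    rw [← sub_eq_zero, ← norm_eq_zero]
    refine le_antisymm (le_of_forall_pos_le_add fun ε hε => ?_) (norm_nonneg _)
    obtain ⟨k, hk⟩ := (TopologicalSpace.denseRange_denseSeq M).exists_dist_lt (v - w)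
      (half_pos hε)
    rw [dist_comm, dist_eq_norm] at hk
    set d := TopologicalSpace.denseSeq M k
    have h0 : ℓ k ((v - w : M) : E) = 0 := by
      have := congrFun hvw k
      simpa [ι, sub_eq_zero] using this
    have h1 : ‖d‖ ≤ ‖d - (v - w)‖ := by
      calc ‖d‖ = ℓ k ((d - (v - w) : M) : E) := by
            rw [Submodule.coe_sub, map_sub, h0, sub_zero, hℓd]
            rfl
        _ ≤ ‖ℓ k‖ * ‖((d - (v - w) : M) : E)‖ := (le_abs_self _).trans ((ℓ k).le_opNorm _)
        _ ≤ 1 * ‖d - (v - w)‖ := by gcongr; exacts [hℓ k, le_rfl]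
        _ = _ := one_mul _
    have h2 : ‖v - w‖ ≤ ‖d‖ + ‖d - (v - w)‖ := by
      have := norm_sub_le d (d - (v - w))
      rwa [sub_sub_cancel] at this
    linarith
  have hmeas : Measurable fun s => (⟨u s, huM s⟩ : M) := by
    rw [← hι.measurable_comp_iff]
    exact measurable_pi_iff.2 fun k => measurable_of_tendsto_nhdsGT (hu (ℓ k))
  exact continuous_subtype_val.comp_stronglyMeasurable hmeas.stronglyMeasurable

/-- A semigroup of operators on a Banach space which is bounded near `0` and weakly continuous
at `0` is strongly continuous at `0`. -/
theorem tendsto_semigroup_of_weak (P : ℝ≥0 → E →L[ℝ] E)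
    (hadd : ∀ t s, P (t + s) = (P t).comp (P s)) (hzero : P 0 = ContinuousLinearMap.id ℝ E)
    {C ε : ℝ} (hε : 0 < ε) (hC : ∀ t : ℝ≥0, (t : ℝ) ≤ ε → ‖P t‖ ≤ C)
    (hweak : ∀ (ℓ : StrongDual ℝ E) (f : E), Tendsto (fun t => ℓ (P t f)) (𝓝[>] 0) (𝓝 (ℓ f)))
    (f : E) : Tendsto (fun t => P t f) (𝓝[>] 0) (𝓝 f) := by
  let Y : Submodule ℝ E :=
    { carrier := {g | Tendsto (fun t => P t g) (𝓝[>] 0) (𝓝 g)}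
      zero_mem' := by simp
      add_mem' := fun {g₁ g₂} h₁ h₂ => by simpa using Tendsto.add h₁ h₂
      smul_mem' := fun c g h => by simpa using Tendsto.const_smul h c }
  have hC0 : 0 ≤ C := (norm_nonneg _).trans (hC 0 hε.le)
  have hsmall : ∀ δ : ℝ, 0 < δ → ∀ᶠ t : ℝ≥0 in 𝓝[>] 0, (t : ℝ) < δ := fun δ hδ =>
    nhdsWithin_le_nhds ((NNReal.continuous_coe.tendsto 0).eventually (gt_mem_nhds (by simpa)))
  have hYcl : IsClosed (Y : Set E) := by
    refine isClosed_of_closure_subset fun g hg => Metric.tendsto_nhds.2 fun δ hδ => ?_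
    obtain ⟨y, hy, hgy⟩ := Metric.mem_closure_iff.1 hg (δ / (C + 2)) (by positivity)
    rw [dist_eq_norm, lt_div_iff₀ (by positivity)] at hgy
    filter_upwards [hsmall ε hε, Metric.tendsto_nhds.1 hy (‖g - y‖ + (δ - ‖g - y‖ * (C + 2)))
      (by linarith [norm_nonneg (g - y)])] with t ht hty
    rw [dist_eq_norm] at hty ⊢
    have h1 : ‖P t (g - y)‖ ≤ C * ‖g - y‖ := (P t).le_of_opNorm_le (hC t ht.le) _
    have h2 : P t g - g = P t (g - y) + (P t y - y) - (g - y) := by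
      rw [map_sub]
      abel
    rw [h2]
    linarith [norm_sub_le (P t (g - y) + (P t y - y)) (g - y),
      norm_add_le (P t (g - y)) (P t y - y)]
  by_contra hf
  obtain ⟨ℓ, hℓ, hne⟩ := Submodule.exists_dual_ne_zero_of_notMem hYcl (x := f) hf
  let u : ℝ → E := fun s => P s.toNNReal f
  have hu_shift : ∀ (t : ℝ≥0) (s : ℝ), 0 ≤ s → u (s + t) = P t (u s) := fun t s hs => by
    show P (s + t).toNNReal f = P t (P s.toNNReal f)
    rw [Real.toNNReal_add hs t.coe_nonneg, Real.toNNReal_coe, add_comm, hadd]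
    rfl
  have hu_bound : ∀ s, s ≤ ε → ‖u s‖ ≤ C * ‖f‖ := fun s hs =>
    (P _).le_of_opNorm_le (hC _ (by simp [hs, hε.le])) f
  have hu_weak : ∀ (ℓ : StrongDual ℝ E) (s : ℝ),
      Tendsto (fun r => ℓ (u r)) (𝓝[>] s) (𝓝 (ℓ (u s))) := fun ℓ s => by
    rcases lt_or_ge s 0 with hs | hs
    · refine tendsto_nhdsWithin_of_tendsto_nhds (tendsto_const_nhds.congr' ?_)
      filter_upwards [gt_mem_nhds hs] with r hr
      simp only [u, Real.toNNReal_of_nonpos hs.le, Real.toNNReal_of_nonpos (le_of_lt hr)]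
    · have h : Tendsto (fun r : ℝ => (r - s).toNNReal) (𝓝[>] s) (𝓝[>] 0) := by
        refine tendsto_nhdsWithin_iff.2 ⟨tendsto_nhdsWithin_of_tendsto_nhds ?_, ?_⟩
        · have : Continuous fun r : ℝ => (r - s).toNNReal := by fun_prop
          simpa using this.tendsto s
        · filter_upwards [self_mem_nhdsWithin] with r hr
          exact Real.toNNReal_pos.2 (sub_pos.2 hr)
      refine ((hweak ℓ (u s)).comp h).congr' ?_
      filter_upwards [self_mem_nhdsWithin] with r hr
      rw [Function.comp_apply, ← hu_shift _ _ hs, Real.coe_toNNReal _ (sub_pos.2 hr).le,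
        add_sub_cancel]
  have hu_meas : StronglyMeasurable u := stronglyMeasurable_of_weakly_rightContinuous hu_weak
  have hu_int : ∀ a b, a ≤ ε → b ≤ ε → IntervalIntegrable u volume a b := fun a b ha hb =>
    (intervalIntegrable_const (c := C * ‖f‖)).mono_fun' hu_meas.aestronglyMeasurable
      ((ae_restrict_iff' measurableSet_uIoc).2 (Eventually.of_forall fun s hs =>
        hu_bound s (hs.2.trans (max_le ha hb))))
  have hY : ∀ h, 0 ≤ h → h ≤ ε / 2 → ∫ s in (0 : ℝ)..h, u s ∈ Y := fun h h0 hh => by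
    have hle : ∀ᶠ t : ℝ≥0 in 𝓝[>] 0,
        ‖P t (∫ s in (0 : ℝ)..h, u s) - ∫ s in (0 : ℝ)..h, u s‖ ≤ 2 * (C * ‖f‖) * t := by
      filter_upwards [hsmall (ε / 2) (half_pos hε)] with t ht
      have ht0 := t.coe_nonneg
      have h1 : P t (∫ s in (0 : ℝ)..h, u s) = ∫ s in (t : ℝ)..(h + t), u s := by
        rw [← ContinuousLinearMap.intervalIntegral_comp_comm _
          (hu_int 0 h hε.le (by linarith))]
        have h2 := intervalIntegral.integral_comp_add_right (a := 0) (b := h) u (t : ℝ)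
        rw [zero_add] at h2
        rw [← h2]
        refine intervalIntegral.integral_congr fun s hs => ?_
        rw [Set.uIcc_of_le h0] at hs
        exact (hu_shift t s hs.1).symm
      rw [h1, ← intervalIntegral.integral_interval_sub_interval_comm'
        (hu_int _ _ (by linarith) (by linarith)) (hu_int _ _ (by linarith) (by linarith))
        (hu_int _ _ (by linarith) (by linarith))]
      have hbd : ∀ a b, a ≤ b → b ≤ ε → ‖∫ s in a..b, u s‖ ≤ C * ‖f‖ * (b - a) :=
        fun a b hab hb => by
          have := intervalIntegral.norm_integral_le_of_norm_le_const (f := u) (a := a) (b := b)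
            fun s hs => hu_bound s (hs.2.trans (max_le (hab.trans hb) hb))
          rwa [abs_of_nonneg (sub_nonneg.2 hab)] at this
      have h3 := hbd h (h + t) (by linarith) (by linarith)
      have h4 := hbd 0 t ht0 (by linarith)
      refine (norm_sub_le _ _).trans ?_
      linarith
    refine tendsto_iff_norm_sub_tendsto_zero.2
      (squeeze_zero' (Eventually.of_forall fun _ => norm_nonneg _) hle ?_)
    have : Tendsto (fun t : ℝ≥0 => 2 * (C * ‖f‖) * (t : ℝ)) (𝓝 0) (𝓝 (2 * (C * ‖f‖) * 0)) :=
      (NNReal.continuous_coe.tendsto 0).const_mul _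
    rw [mul_zero] at this
    exact tendsto_nhdsWithin_of_tendsto_nhds this
  have hderiv : HasDerivWithinAt (fun h => ∫ s in (0 : ℝ)..h, ℓ (u s)) (ℓ (u 0)) (Set.Ici 0) 0 :=
    intervalIntegral.integral_hasDerivWithinAt_right IntervalIntegrable.refl (t := Set.Ioi 0)
      (ℓ.continuous.comp_stronglyMeasurable hu_meas).stronglyMeasurableAtFilter (hu_weak ℓ 0)
  have hzero' : (fun h => ∫ s in (0 : ℝ)..h, ℓ (u s)) =ᶠ[𝓝[≥] 0] fun _ => 0 := by
    filter_upwards [Icc_mem_nhdsGE (half_pos hε)] with h hh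
    rw [ContinuousLinearMap.intervalIntegral_comp_comm _
      (hu_int 0 h hε.le (hh.2.trans (half_le_self hε.le)))]
    exact hℓ _ (hY h hh.1 hh.2)
  have hd0 := (hasDerivWithinAt_const (0 : ℝ) (Set.Ici 0) (0 : ℝ)).congr_of_eventuallyEq hzero'
    (by simp)
  have hu0 : ℓ (u 0) = 0 := (uniqueDiffWithinAt_Ici 0).eq_deriv _ hderiv hd0
  refine hne ?_
  simpa [u, hzero] using hu0

end Semigroup

theorem mainTheorem2 {X : Type*} [TopologicalSpace X] [T35Space X] (ψ : AdmissibleWeight X)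
    (P : ℝ≥0 → (ControlledGrowth ψ →L[ℝ] ControlledGrowth ψ))
    (hP_zero : P 0 = ContinuousLinearMap.id ℝ (ControlledGrowth ψ))
    (hP_add : ∀ t s : ℝ≥0, P (t + s) = (P t).comp (P s))
    (hP_pointwise : ∀ (f : ControlledGrowth ψ) (x : X),
      Tendsto (fun t : ℝ≥0 => (P t f).1 x) (𝓝[>] 0) (𝓝 (f.1 x)))
    (hP_bound : ∃ C : ℝ, ∃ ε : ℝ, 0 < ε ∧ ∀ t : ℝ≥0, (t : ℝ) ≤ ε → ‖P t‖ ≤ C) :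
    ∀ f : ControlledGrowth ψ, Tendsto (fun t : ℝ≥0 => ‖P t f - f‖) (𝓝[>] 0) (𝓝 0) := by
  intro f
  obtain ⟨C, ε, hε, hC⟩ := hP_bound
  rw [← tendsto_iff_norm_sub_tendsto_zero]
  have : CompleteSpace (ControlledGrowth ψ) :=
    (Submodule.isClosed_topologicalClosure _).completeSpace_coe
  refine tendsto_semigroup_of_weak P hP_add hP_zero hε hC (fun ℓ g => ?_) f
  refine ControlledGrowth.tendsto_dual_of_pointwise ℓ (C := C * ‖g‖) ?_ (hP_pointwise g)
  have hmem : ∀ᶠ t : ℝ≥0 in 𝓝[>] 0, (t : ℝ) < ε :=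
    nhdsWithin_le_nhds ((NNReal.continuous_coe.tendsto 0).eventually (gt_mem_nhds (by simpa)))
  filter_upwards [hmem] with t ht
  exact (P t).le_of_opNorm_le (hC t ht.le) g
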